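/- Let $\mathbb{F}$ be $\mathbb{R}$ or $\mathbb{C}$, let $\ell_1=\ell_1(\mathbb{N};\mathbb{F})$, and let $\mathcal{E}=(e_n)_{n=1}^\infty$ be its unit vector system. For every $C\ge 1$ there is a norm $\|\cdot\|$ on $\ell_1$, equivalent to the usual one, such that $\mathcal{E}$ is a Schauder basis of $\mathbb{X}=(\ell_1,\|\cdot\|)$ with the following properties. Here $S_A(f)=\sum_{n\in A}a_n e_n$ for $A\subseteq\mathbb{N}$ and $f=\sum_n a_n e_n\in\ell_1$, and $e_n^*\in\mathbb{X}^*$ are the coordinate functionals, $e_n^*(f)=a_n$. 1. $\mathcal{E}$ has Property (A): $\|x\|=\|y\|$ whenever $x=\sum_n a_n e_n$ and $y=\sum_n b_n e_n$ in $\ell_1$ are such that $y$ is a greedy rearrangement of $x$, i.e., there is a bijection $\pi\colon\mathbb{N}\to\mathbb{N}$ with $|b_{\pi(n)}|=|a_n|$ for all $n$, and $\pi(k)=k$ and $b_k=a_k$ whenever $0<|a_k|<\sup_n|a_n|$. 2. $\mathcal{E}$ is not $C$-suppression unconditional: it is not the case that $\|S_A(f)\|\le C\|f\|$ for all finite $A\subset\mathbb{N}$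 and all $f\in\ell_1$. 3. $\mathcal{E}$ is isometrically bidemocratic: for every $m\in\mathbb{N}$, $$\Big(\sup_{|A|\le m,\ |\varepsilon_n|=1}\Big\|\sum_{n\in A}\varepsilon_n e_n\Big\|\Big)\Big(\sup_{|A|\le m,\ |\varepsilon_n|=1}\Big\|\sum_{n\in A}\varepsilon_n e_n^*\Big\|_{\mathbb{X}^*}\Big)\le m.$$ 4. $\mathcal{E}$ is bimonotone: $\|S_I(f)\|\le\|f\|$ for every (bounded or unbounded) interval $I$ of $\mathbb{N}$ and every $f\in\ell_1$. -/

import Mathlib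

open scoped ENNReal

noncomputable section

/-- A renorming of a normed space `E`: a norm on the vector space `E` which is equivalent
to the given one. -/
structure Renorming (𝕜 : Type*) [RCLike 𝕜] (E : Type*) [NormedAddCommGroup E]
    [NormedSpace 𝕜 E] where
  /-- The new norm. -/
  newNorm : Seminorm 𝕜 E
  /-- The new norm is equivalent to the original one (in particular, it is a norm). -/
  equivalent : ∃ c K : ℝ, 0 < c ∧ ∀ x : E, c * ‖x‖ ≤ newNorm x ∧ newNorm x ≤ K * ‖x‖

namespace Renorming

variable {𝕜 : Type*} [RCLike 𝕜] {E : Type*} [NormedAddCommGroup E] [NormedSpace 𝕜 E]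

theorem eq_zero_of_newNorm_eq_zero (N : Renorming 𝕜 E) (x : E) (hx : N.newNorm x = 0) :
    x = 0 := by
  obtain ⟨c, K, hc, h⟩ := N.equivalent
  have h1 : c * ‖x‖ ≤ 0 := hx ▸ (h x).1
  have h2 : ‖x‖ ≤ 0 := by
    by_contra! h3
    exact absurd (mul_pos hc h3) (not_lt.mpr h1)
  exact norm_le_zero_iff.mp h2

/-- The vector space `E`, to be endowed with the new norm. -/
def Space (_N : Renorming 𝕜 E) : Type _ := E

instance (N : Renorming 𝕜 E) : AddCommGroup N.Space := inferInstanceAs (AddCommGroup E)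

instance (N : Renorming 𝕜 E) : Module 𝕜 N.Space := inferInstanceAs (Module 𝕜 E)

/-- The identity map from `E` onto `E` with the new norm. -/
def toSpace (N : Renorming 𝕜 E) : E ≃ₗ[𝕜] N.Space := LinearEquiv.refl 𝕜 E

instance (N : Renorming 𝕜 E) : NormedAddCommGroup N.Space :=
  AddGroupNorm.toNormedAddCommGroup
    { toFun := fun x => N.newNorm (N.toSpace.symm x)
      map_zero' := by simp
      add_le' := fun x y => by simpa using map_add_le_add N.newNorm _ _
      neg' := fun x => by simp
      eq_zero_of_map_eq_zero' := fun x hx => by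
        simpa using N.eq_zero_of_newNorm_eq_zero _ hx }

theorem norm_toSpace (N : Renorming 𝕜 E) (x : E) : ‖N.toSpace x‖ = N.newNorm x := rfl

instance (N : Renorming 𝕜 E) : NormedSpace 𝕜 N.Space where
  norm_smul_le a x := (map_smul_eq_mul N.newNorm a (N.toSpace.symm x)).le

end Renorming

namespace SchauderBasis

variable {𝕜 : Type*} [RCLike 𝕜] {X : Type*} [NormedAddCommGroup X] [NormedSpace 𝕜 X]

/-- `y` is a greedy rearrangement of `x`: the coefficients of `x` of maximum modulus are
relocated and multiplied by scalars of modulus one, while every other nonzero coefficient is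
left untouched. The condition `∃ j, ‖b.coord k x‖ < ‖b.coord j x‖` says that the modulus of
the `k`-th coefficient is smaller than the supremum of the moduli of all of them. -/
def IsGreedyRearrangement (b : SchauderBasis 𝕜 X) (x y : X) : Prop :=
  ∃ π : Equiv.Perm ℕ, (∀ n, ‖b.coord (π n) y‖ = ‖b.coord n x‖) ∧
    ∀ k, b.coord k x ≠ 0 → (∃ j, ‖b.coord k x‖ < ‖b.coord j x‖) →
      π k = k ∧ b.coord k y = b.coord k x

/-- Property (A). -/
def PropertyA (b : SchauderBasis 𝕜 X) : Prop :=
  ∀ x y : X, IsGreedyRearrangement b x y → ‖x‖ = ‖y‖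

/-- `C`-suppression unconditionality: the coordinate projections on finite sets are
bounded by `C`. -/
def IsSuppressionUnconditional (b : SchauderBasis 𝕜 X) (C : ℝ) : Prop :=
  ∀ (A : Finset ℕ) (x : X), ‖GeneralSchauderBasis.proj b A x‖ ≤ C * ‖x‖

/-- The coordinate projection on any interval of `ℕ`, bounded (first clause) or
unbounded (second clause), has norm at most one. -/
def IsBimonotone (b : SchauderBasis 𝕜 X) : Prop :=
  (∀ (i j : ℕ) (x : X), ‖GeneralSchauderBasis.proj b (Finset.Ico i j) x‖ ≤ ‖x‖) ∧
    ∀ (i : ℕ) (x : X), ‖x - GeneralSchauderBasis.proj b (Finset.range i) x‖ ≤ ‖x‖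

/-- The fundamental function of a sequence `v`: the `m`-th value is the supremum of
`‖∑ n ∈ A, ε n • v n‖` over all sets `A` of at most `m` indices and all choices of scalars
`ε n` of modulus one. -/
def fundamentalFunction (𝕜 : Type*) [RCLike 𝕜] {Y : Type*} [NormedAddCommGroup Y]
    [NormedSpace 𝕜 Y] (v : ℕ → Y) (m : ℕ) : ℝ≥0∞ :=
  ⨆ (A : Finset ℕ) (_ : A.card ≤ m) (ε : ℕ → 𝕜) (_ : ∀ n ∈ A, ‖ε n‖ = 1),
    ‖∑ n ∈ A, ε n • v n‖ₑ

/-- Isometric bidemocracy: the product of the `m`-th values of the fundamental functions of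
the basis and of its coordinate functionals (in the dual space) is at most `m`. -/
def IsIsometricallyBidemocratic (b : SchauderBasis 𝕜 X) : Prop :=
  ∀ m : ℕ, fundamentalFunction 𝕜 b.basis m * fundamentalFunction 𝕜 b.coord m ≤ m

end SchauderBasis

end

/-! Fix a nonincreasing positive weight `w`, bounded below, and put φ(m) = 2(w_0 + ... + w_{m-1}).
The new norm is the supremum, over finite D and intervals [i, j), of `hybridForm`: φ(#D)/#D times
the ℓ₁ norm on D, plus the modulus of the w-sum over indices of [i, j) outside D and at least #D.

Property (A) rests on `hybridForm_le_insert`: adjoining a position of maximal modulus to D never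
lowers the form. Hence D may be assumed to contain all such positions, and a greedy rearrangement
then merely transports D (`hybridForm_map_equiv`). The same absorption bounds sums of m unimodular
terms by φ(m), while the D-part alone bounds the dual sums by m/φ(m). Bimonotonicity holds because
intervals are closed under intersection.

For conditionality take w_n = 1/√(n+1), frozen from index M on so that it stays bounded below, and
x_n = (-1)^n/√(n+1) for n < M. Cancellation keeps the norm of x at most 9, but its even part pairs
with w to give ∑ 1/(2k+1), which is unbounded as M grows. -/

/-- Twice the sum of the first `m` terms of `w`. -/
noncomputable def doubledPartialSum (w : ℕ → ℝ) (m : ℕ) : ℝ := 2 * ∑ j ∈ Finset.range m, w j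

/-- The indices of `[i, j)` outside `D` that are at least `#D`. -/
def tailIndices (D : Finset ℕ) (i j : ℕ) : Finset ℕ :=
  (Finset.Ico i j).filter fun n => n ∉ D ∧ D.card ≤ n

/-- The sum of a weighted `ℓ₁` norm on `D` and the modulus of the functional with
coefficients `w` on the indices of `[i, j)` that are outside `D` and at least `#D`. -/
noncomputable def hybridForm {𝕜 : Type*} [RCLike 𝕜] (w : ℕ → ℝ) (D : Finset ℕ) (i j : ℕ)
    (x : ℕ → 𝕜) : ℝ :=
  doubledPartialSum w D.card / D.card * ∑ n ∈ D, ‖x n‖ +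
    ‖∑ n ∈ tailIndices D i j, (w n : 𝕜) * x n‖

/-! ### Averages of a nonincreasing weight -/

section DoubledPartialSum

variable {w : ℕ → ℝ}

theorem doubledPartialSum_zero : doubledPartialSum w 0 = 0 := by simp [doubledPartialSum]

theorem doubledPartialSum_succ (m : ℕ) :
    doubledPartialSum w (m + 1) = doubledPartialSum w m + 2 * w m := by
  simp only [doubledPartialSum, Finset.sum_range_succ]; ring

theorem doubledPartialSum_nonneg (hpos : ∀ n, 0 ≤ w n) (m : ℕ) : 0 ≤ doubledPartialSum w m :=
  mul_nonneg zero_le_two (Finset.sum_nonneg fun n _ => hpos n)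

theorem doubledPartialSum_mono (hpos : ∀ n, 0 ≤ w n) : Monotone (doubledPartialSum w) :=
  monotone_nat_of_le_succ fun m => by
    rw [doubledPartialSum_succ]; linarith [hpos m]

theorem two_mul_mul_le_doubledPartialSum (hw : Antitone w) (m : ℕ) :
    m * (2 * w m) ≤ doubledPartialSum w m := by
  have h : (Finset.range m).card • w m ≤ ∑ j ∈ Finset.range m, w j :=
    Finset.card_nsmul_le_sum _ _ _ fun j hj => hw (Finset.mem_range.1 hj).le
  rw [Finset.card_range, nsmul_eq_mul] at h
  simp only [doubledPartialSum]; linarith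

theorem doubledPartialSum_div_nonneg (hpos : ∀ n, 0 ≤ w n) (m : ℕ) :
    0 ≤ doubledPartialSum w m / m :=
  div_nonneg (doubledPartialSum_nonneg hpos m) m.cast_nonneg

theorem doubledPartialSum_div_succ_le (hw : Antitone w) {m : ℕ} (hm : m ≠ 0) :
    doubledPartialSum w (m + 1) / (m + 1 : ℕ) ≤ doubledPartialSum w m / m := by
  have hm' : (0 : ℝ) < m := by positivity
  rw [div_le_div_iff₀ (by positivity) hm', doubledPartialSum_succ]
  push_cast
  nlinarith [two_mul_mul_le_doubledPartialSum hw m]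

theorem doubledPartialSum_div_anti (hw : Antitone w) {m k : ℕ} (hm : m ≠ 0) (hmk : m ≤ k) :
    doubledPartialSum w k / k ≤ doubledPartialSum w m / m := by
  induction k, hmk using Nat.le_induction with
  | base => exact le_rfl
  | succ k hk ih => exact (doubledPartialSum_div_succ_le hw (by omega)).trans ih

theorem doubledPartialSum_div_le (hw : Antitone w) (hpos : ∀ n, 0 ≤ w n) (m : ℕ) :
    doubledPartialSum w m / m ≤ 2 * w 0 := by
  rcases eq_or_ne m 0 with rfl | hm
  · simpa using hpos 0
  · refine (doubledPartialSum_div_anti hw one_ne_zero (Nat.one_le_iff_ne_zero.2 hm)).trans ?_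
    simp [doubledPartialSum]

theorem le_doubledPartialSum_div {c : ℝ} (hc : ∀ n, c ≤ w n) {m : ℕ} (hm : m ≠ 0) :
    2 * c ≤ doubledPartialSum w m / m := by
  have h : (Finset.range m).card • c ≤ ∑ j ∈ Finset.range m, w j :=
    Finset.card_nsmul_le_sum _ _ _ fun j _ => hc j
  rw [Finset.card_range, nsmul_eq_mul] at h
  rw [le_div_iff₀ (by positivity)]
  simp only [doubledPartialSum]; linarith

/-- The averages φ(m)/m decrease, so right side minus left side is nonincreasing in S; at the
extreme S = m t both sides agree. The case m = 0 relies on division by zero being zero. -/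
theorem doubledPartialSum_div_mul_add_le (hw : Antitone w) (hpos : ∀ n, 0 ≤ w n) {m : ℕ}
    {S t : ℝ} (hS₀ : 0 ≤ S) (hS : S ≤ m * t) :
    doubledPartialSum w m / m * S + 2 * w m * t ≤
      doubledPartialSum w (m + 1) / (m + 1 : ℕ) * (t + S) := by
  rcases eq_or_ne m 0 with rfl | hm
  · have := mul_nonneg (hpos 0) hS₀
    simp [doubledPartialSum_succ, doubledPartialSum_zero]
    linarith
  · have hm' : (m : ℝ) ≠ 0 := by positivity
    have h := mul_le_mul_of_nonneg_left hS
      (sub_nonneg.2 (doubledPartialSum_div_succ_le hw hm))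
    have h1 : doubledPartialSum w (m + 1) / (m + 1 : ℕ) * (t + m * t) =
        doubledPartialSum w m / m * (m * t) + 2 * w m * t := by
      rw [doubledPartialSum_succ]; push_cast; field_simp; ring
    linarith

end DoubledPartialSum

/-! ### The forms whose supremum is the norm -/

section HybridForm

variable {𝕜 : Type*} [RCLike 𝕜] {w : ℕ → ℝ}

theorem norm_ofReal_mul (hpos : ∀ n, 0 ≤ w n) (n : ℕ) (z : 𝕜) :
    ‖(w n : 𝕜) * z‖ = w n * ‖z‖ := by
  rw [norm_mul, RCLike.norm_of_nonneg (hpos n)]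

theorem hybridForm_zero (D : Finset ℕ) (i j : ℕ) : hybridForm w D i j (0 : ℕ → 𝕜) = 0 := by
  simp [hybridForm]

theorem hybridForm_add_le (hpos : ∀ n, 0 ≤ w n) (D : Finset ℕ) (i j : ℕ) (x y : ℕ → 𝕜) :
    hybridForm w D i j (x + y) ≤ hybridForm w D i j x + hybridForm w D i j y := by
  have h1 : ∑ n ∈ D, ‖(x + y) n‖ ≤ ∑ n ∈ D, ‖x n‖ + ∑ n ∈ D, ‖y n‖ := by
    rw [← Finset.sum_add_distrib]
    exact Finset.sum_le_sum fun n _ => norm_add_le _ _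
  have h2 := mul_le_mul_of_nonneg_left h1 (doubledPartialSum_div_nonneg hpos D.card)
  have h3 := norm_add_le (∑ n ∈ tailIndices D i j, (w n : 𝕜) * x n)
    (∑ n ∈ tailIndices D i j, (w n : 𝕜) * y n)
  rw [← Finset.sum_add_distrib] at h3
  simp only [← mul_add] at h3
  simp only [hybridForm, Pi.add_apply] at *
  linarith

theorem hybridForm_smul (D : Finset ℕ) (i j : ℕ) (r : 𝕜) (x : ℕ → 𝕜) :
    hybridForm w D i j (r • x) = ‖r‖ * hybridForm w D i j x := by
  simp only [hybridForm, Pi.smul_apply, smul_eq_mul, norm_mul, mul_left_comm _ r,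
    ← Finset.mul_sum]
  ring

theorem hybridForm_le_of_sum_le (hw : Antitone w) (hpos : ∀ n, 0 ≤ w n) (D : Finset ℕ) (i j : ℕ)
    {x : ℕ → 𝕜} {K : ℝ} (hx : ∀ s : Finset ℕ, ∑ n ∈ s, ‖x n‖ ≤ K) :
    hybridForm w D i j x ≤ 3 * w 0 * K := by
  have h1 : doubledPartialSum w D.card / D.card * ∑ n ∈ D, ‖x n‖ ≤ 2 * w 0 * K :=
    mul_le_mul (doubledPartialSum_div_le hw hpos _) (hx D)
      (Finset.sum_nonneg fun _ _ => norm_nonneg _) (mul_nonneg zero_le_two (hpos 0))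
  have h2 : ‖∑ n ∈ tailIndices D i j, (w n : 𝕜) * x n‖ ≤ w 0 * K := by
    refine (norm_sum_le _ _).trans ?_
    refine le_trans (Finset.sum_le_sum fun n _ => ?_)
      ((Finset.mul_sum _ _ _).symm.trans_le
        (mul_le_mul_of_nonneg_left (hx (tailIndices D i j)) (hpos 0)))
    rw [norm_ofReal_mul hpos]
    exact mul_le_mul_of_nonneg_right (hw n.zero_le) (norm_nonneg _)
  simp only [hybridForm]; linarith

theorem mul_sum_norm_le_hybridForm {c : ℝ} (hc : ∀ n, c ≤ w n) (D : Finset ℕ) (x : ℕ → 𝕜) :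
    2 * c * ∑ n ∈ D, ‖x n‖ ≤ hybridForm w D 0 0 x := by
  rcases D.eq_empty_or_nonempty with rfl | hD
  · simp [hybridForm]
  · refine le_add_of_le_of_nonneg ?_ (norm_nonneg _)
    exact mul_le_mul_of_nonneg_right (le_doubledPartialSum_div hc hD.card_ne_zero)
      (Finset.sum_nonneg fun _ _ => norm_nonneg _)

/-- The tail loses at most two indices, `y` itself and the index `#D` excluded by the raised
threshold. Both are at least `#D`, so the loss is at most 2 w_{#D} t, which the D-part regains. This
is why the partial sums are doubled. -/
theorem hybridForm_le_insert (hw : Antitone w) (hpos : ∀ n, 0 ≤ w n) {D : Finset ℕ} {i j y : ℕ}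
    {x : ℕ → 𝕜} (hy : y ∉ D) (hx : ∀ n, ‖x n‖ ≤ ‖x y‖) :
    hybridForm w D i j x ≤ hybridForm w (insert y D) i j x := by
  set t := ‖x y‖
  have hsub : tailIndices (insert y D) i j ⊆ tailIndices D i j := by
    intro n hn
    simp only [tailIndices, Finset.mem_filter, Finset.mem_insert,
      Finset.card_insert_of_notMem hy] at hn ⊢
    exact ⟨hn.1, by tauto, by omega⟩
  have hcard : (tailIndices D i j \ tailIndices (insert y D) i j).card ≤ 2 := by
    refine (Finset.card_le_card (t := {y, D.card}) ?_).trans Finset.card_le_two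
    intro n hn
    simp only [tailIndices, Finset.mem_sdiff, Finset.mem_filter, Finset.mem_insert,
      Finset.card_insert_of_notMem hy, Finset.mem_singleton] at hn ⊢
    by_contra! h
    exact hn.2 ⟨hn.1.1, by tauto, by omega⟩
  have hloss : ‖∑ n ∈ tailIndices D i j \ tailIndices (insert y D) i j, (w n : 𝕜) * x n‖ ≤
      2 * (w D.card * t) := by
    have h0 : 0 ≤ w D.card * t := mul_nonneg (hpos _) (norm_nonneg _)
    refine (norm_sum_le_of_le (f := fun n => (w n : 𝕜) * x n) _ fun n hn => ?_).trans
      ((Finset.sum_const (w D.card * t)).trans_le ?_)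
    · rw [norm_ofReal_mul hpos]
      refine mul_le_mul (hw ?_) (hx n) (norm_nonneg _) (hpos _)
      exact (Finset.mem_filter.1 (Finset.mem_sdiff.1 hn).1).2.2
    · rw [nsmul_eq_mul]
      exact mul_le_mul_of_nonneg_right (mod_cast hcard) h0
  have hS : ∑ n ∈ D, ‖x n‖ ≤ D.card * t := by
    simpa using Finset.sum_le_card_nsmul D (fun n => ‖x n‖) t fun n _ => hx n
  have hgain := doubledPartialSum_div_mul_add_le hw hpos
    (Finset.sum_nonneg fun n _ => norm_nonneg (x n)) hS
  have hsplit := Finset.sum_sdiff hsub (f := fun n => (w n : 𝕜) * x n)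
  have htri := norm_add_le
    (∑ n ∈ tailIndices D i j \ tailIndices (insert y D) i j, (w n : 𝕜) * x n)
    (∑ n ∈ tailIndices (insert y D) i j, (w n : 𝕜) * x n)
  rw [hsplit] at htri
  simp only [hybridForm, Finset.sum_insert hy, Finset.card_insert_of_notMem hy]
  linarith

theorem hybridForm_le_union (hw : Antitone w) (hpos : ∀ n, 0 ≤ w n) (D A : Finset ℕ) (i j : ℕ)
    {x : ℕ → 𝕜} (hx : ∀ y ∈ A, ∀ n, ‖x n‖ ≤ ‖x y‖) :
    hybridForm w D i j x ≤ hybridForm w (A ∪ D) i j x := by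
  induction A using Finset.induction_on with
  | empty => simp
  | insert y A _ ih =>
    refine (ih fun z hz => hx z (Finset.mem_insert_of_mem hz)).trans ?_
    rw [Finset.insert_union]
    by_cases h : y ∈ A ∪ D
    · rw [Finset.insert_eq_of_mem h]
    · exact hybridForm_le_insert hw hpos h (hx y (Finset.mem_insert_self y A))

/-- The tail threshold depends on D only through its cardinality, which π preserves, and nonzero
entries outside D do not move. -/
theorem hybridForm_map_equiv (D : Finset ℕ) (i j : ℕ) {x y : ℕ → 𝕜} (π : Equiv.Perm ℕ)
    (hπ : ∀ n, ‖y (π n)‖ = ‖x n‖) (hfix : ∀ n, n ∉ D → x n ≠ 0 → π n = n ∧ y n = x n) :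
    hybridForm w (D.map π.toEmbedding) i j y = hybridForm w D i j x := by
  have key : ∑ n ∈ tailIndices (D.map π.toEmbedding) i j, (w n : 𝕜) * y n =
      ∑ n ∈ tailIndices D i j, (w n : 𝕜) * x n := by
    simp only [tailIndices, Finset.card_map, Finset.sum_filter]
    refine Finset.sum_congr rfl fun n _ => ?_
    by_cases hx : n ∉ D ∧ x n ≠ 0
    · obtain ⟨h1, h2⟩ := hfix n hx.1 hx.2
      have h3 : n ∉ D.map π.toEmbedding := by
        rw [Finset.mem_map_equiv, (Equiv.symm_apply_eq π).2 h1.symm]; exact hx.1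
      simp only [hx.1, h3, h2, not_false_eq_true, true_and]
    · have hl : n ∈ D ∨ x n = 0 := by tauto
      have hr : n ∈ D.map π.toEmbedding ∨ y n = 0 := by
        -- A nonzero entry of `y` outside π(D) comes from a nonzero entry of `x` outside D; that
        -- position is fixed, so it is `n` itself.
        by_contra! h
        rw [Finset.mem_map_equiv] at h
        have h1 : x (π.symm n) ≠ 0 := by
          rw [← norm_ne_zero_iff, ← hπ, π.apply_symm_apply, norm_ne_zero_iff]; exact h.2
        have h2 := (hfix _ h.1 h1).1
        rw [π.apply_symm_apply] at h2
        rw [← h2] at h h1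
        tauto
      rcases hl with hl | hl <;> rcases hr with hr | hr <;>
        simp [hl, hr, -Finset.mem_map_equiv]
  simp only [hybridForm, key, Finset.card_map, Finset.sum_map, Equiv.coe_toEmbedding, hπ]

theorem exists_hybridForm_le_of_greedyRearrangement (hw : Antitone w) (hpos : ∀ n, 0 ≤ w n)
    (D : Finset ℕ) (i j : ℕ) {x y : ℕ → 𝕜} (hx : Filter.Tendsto x Filter.cofinite (nhds 0))
    (π : Equiv.Perm ℕ) (hπ : ∀ n, ‖y (π n)‖ = ‖x n‖)
    (hfix : ∀ k, x k ≠ 0 → (∃ l, ‖x k‖ < ‖x l‖) → π k = k ∧ y k = x k) :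
    ∃ D' : Finset ℕ, hybridForm w D i j x ≤ hybridForm w D' i j y := by
  -- Since x tends to zero, its nonzero maximum is attained only finitely often; requiring `x n ≠ 0`
  -- makes the set empty when x = 0.
  have hfin : {n | x n ≠ 0 ∧ ∀ l, ‖x l‖ ≤ ‖x n‖}.Finite := by
    by_cases h0 : ∀ n, x n = 0
    · simp [h0]
    · push Not at h0
      obtain ⟨k, hk⟩ := h0
      have := (hx.norm.eventually_lt_const (by simpa using norm_pos_iff.2 hk) :
        ∀ᶠ n in Filter.cofinite, ‖x n‖ < ‖x k‖)
      exact (Filter.eventually_cofinite.1 this).subset fun n hn => (hn.2 k).not_gt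
  refine ⟨(hfin.toFinset ∪ D).map π.toEmbedding, ?_⟩
  rw [hybridForm_map_equiv _ i j π hπ]
  · exact hybridForm_le_union hw hpos _ _ _ _ fun n hn => ((hfin.mem_toFinset).1 hn).2
  · intro n hn hxn
    refine hfix n hxn ?_
    by_contra! h
    exact hn (Finset.mem_union_left _ (hfin.mem_toFinset.2 ⟨hxn, h⟩))

/-- Once D has absorbed the support A, the tail vanishes and the form is #A times the average at the
larger set, which is at most the average at A. -/
theorem hybridForm_signs_le (hw : Antitone w) (hpos : ∀ n, 0 ≤ w n) (D A : Finset ℕ) (i j : ℕ)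
    {x : ℕ → 𝕜} (h1 : ∀ n ∈ A, ‖x n‖ = 1) (h0 : ∀ n ∉ A, x n = 0) :
    hybridForm w D i j x ≤ doubledPartialSum w A.card := by
  refine (hybridForm_le_union hw hpos D A i j fun y hy n => ?_).trans ?_
  · rw [h1 y hy]
    by_cases hn : n ∈ A
    · exact (h1 n hn).le
    · simp [h0 n hn]
  · have htail : ∑ n ∈ tailIndices (A ∪ D) i j, (w n : 𝕜) * x n = 0 := by
      refine Finset.sum_eq_zero fun n hn => ?_
      have := (Finset.mem_filter.1 hn).2.1
      rw [h0 n fun h => this (Finset.mem_union_left _ h), mul_zero]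
    have hsum : ∑ n ∈ A ∪ D, ‖x n‖ = A.card := by
      rw [← Finset.sum_subset Finset.subset_union_left fun n _ hn => by simp [h0 n hn],
        Finset.sum_congr rfl h1]
      simp
    rw [hybridForm, htail, hsum, norm_zero, add_zero]
    rcases A.eq_empty_or_nonempty with rfl | hA
    · simp [doubledPartialSum_zero]
    · refine (mul_le_mul_of_nonneg_right (doubledPartialSum_div_anti hw hA.card_ne_zero
        (Finset.card_le_card Finset.subset_union_left)) (Nat.cast_nonneg _)).trans_eq ?_
      exact div_mul_cancel₀ _ (Nat.cast_ne_zero.2 hA.card_ne_zero)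

theorem hybridForm_interval_le (hpos : ∀ n, 0 ≤ w n) (D : Finset ℕ) (i j i' j' : ℕ)
    {x y : ℕ → 𝕜} (hin : ∀ n, i' ≤ n → n < j' → y n = x n)
    (hout : ∀ n, i ≤ n → n < j → ¬ (i' ≤ n ∧ n < j') → y n = 0)
    (hle : ∀ n, ‖y n‖ ≤ ‖x n‖) :
    hybridForm w D i j y ≤ hybridForm w D (max i i') (min j j') x := by
  have h : ∑ n ∈ tailIndices D i j, (w n : 𝕜) * y n =
      ∑ n ∈ tailIndices D (max i i') (min j j'), (w n : 𝕜) * x n := by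
    symm
    rw [← Finset.sum_subset (s₁ := tailIndices D (max i i') (min j j'))
      (f := fun n => (w n : 𝕜) * y n)]
    · refine Finset.sum_congr rfl fun n hn => ?_
      simp only [tailIndices, Finset.mem_filter, Finset.mem_Ico] at hn
      rw [hin n (by omega) (by omega)]
    · intro n hn
      simp only [tailIndices, Finset.mem_filter, Finset.mem_Ico] at hn ⊢
      exact ⟨by omega, hn.2⟩
    · intro n hn hn'
      simp only [tailIndices, Finset.mem_filter, Finset.mem_Ico] at hn hn'
      rw [hout n hn.1.1 hn.1.2 (by grind), mul_zero]
  rw [hybridForm, hybridForm, h]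
  gcongr with n
  · exact doubledPartialSum_div_nonneg hpos _
  · exact hle n

end HybridForm

/-! ### The norm and its equivalence with the ℓ₁ norm -/

section HybridNorm

variable {𝕜 : Type*} [RCLike 𝕜] {w : ℕ → ℝ}

theorem sum_norm_le_lp_one_norm (x : lp (fun _ : ℕ => 𝕜) 1) (s : Finset ℕ) :
    ∑ n ∈ s, ‖x n‖ ≤ ‖x‖ := by
  simpa using lp.sum_rpow_le_norm_rpow (p := 1) (by simp) x s

theorem tendsto_cofinite_lp_one (x : lp (fun _ : ℕ => 𝕜) 1) :
    Filter.Tendsto (fun n => x n) Filter.cofinite (nhds 0) := by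
  have h := (lp.memℓp x).summable (by simp)
  rw [tendsto_zero_iff_norm_tendsto_zero]
  simpa using h.tendsto_cofinite_zero

theorem bddAbove_range_hybridForm (hw : Antitone w) (hpos : ∀ n, 0 ≤ w n)
    (x : lp (fun _ : ℕ => 𝕜) 1) :
    BddAbove (Set.range fun p : Finset ℕ × ℕ × ℕ => hybridForm w p.1 p.2.1 p.2.2 x) :=
  ⟨3 * w 0 * ‖x‖, by
    rintro _ ⟨p, rfl⟩
    exact hybridForm_le_of_sum_le hw hpos _ _ _ (sum_norm_le_lp_one_norm x)⟩

/-- The supremum of all the forms `hybridForm w D i j`, as a seminorm on `ℓ₁`. -/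
noncomputable def hybridNorm (𝕜 : Type*) [RCLike 𝕜] {w : ℕ → ℝ} (hw : Antitone w)
    (hpos : ∀ n, 0 ≤ w n) : Seminorm 𝕜 (lp (fun _ : ℕ => 𝕜) 1) :=
  Seminorm.ofSMulLE (fun x => ⨆ p : Finset ℕ × ℕ × ℕ, hybridForm w p.1 p.2.1 p.2.2 x)
    (by simp only [lp.coeFn_zero, hybridForm_zero, ciSup_const])
    (fun x y => ciSup_le fun p => by
      rw [lp.coeFn_add]
      exact (hybridForm_add_le hpos _ _ _ _ _).trans
        (add_le_add (le_ciSup (bddAbove_range_hybridForm hw hpos x) p)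
          (le_ciSup (bddAbove_range_hybridForm hw hpos y) p)))
    (fun r x => ciSup_le fun p => by
      rw [lp.coeFn_smul, hybridForm_smul]
      exact mul_le_mul_of_nonneg_left (le_ciSup (bddAbove_range_hybridForm hw hpos x) p)
        (norm_nonneg r))

theorem hybridForm_le_hybridNorm (hw : Antitone w) (hpos : ∀ n, 0 ≤ w n) (D : Finset ℕ)
    (i j : ℕ) (x : lp (fun _ : ℕ => 𝕜) 1) : hybridForm w D i j x ≤ hybridNorm 𝕜 hw hpos x :=
  le_ciSup (bddAbove_range_hybridForm hw hpos x) (D, i, j)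

theorem hybridNorm_le (hw : Antitone w) (hpos : ∀ n, 0 ≤ w n) {x : lp (fun _ : ℕ => 𝕜) 1}
    {K : ℝ} (h : ∀ D i j, hybridForm w D i j x ≤ K) : hybridNorm 𝕜 hw hpos x ≤ K :=
  ciSup_le fun p => h p.1 p.2.1 p.2.2

theorem mul_norm_le_hybridNorm (hw : Antitone w) (hpos : ∀ n, 0 ≤ w n) {c : ℝ} (hc₀ : 0 < c)
    (hc : ∀ n, c ≤ w n) (x : lp (fun _ : ℕ => 𝕜) 1) :
    2 * c * ‖x‖ ≤ hybridNorm 𝕜 hw hpos x := by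
  rw [← le_div_iff₀' (by positivity)]
  refine lp.norm_le_of_forall_sum_le (by simp) (div_nonneg (apply_nonneg _ _) (by positivity))
    fun s => ?_
  simp only [ENNReal.toReal_one, Real.rpow_one]
  rw [le_div_iff₀' (by positivity)]
  exact (mul_sum_norm_le_hybridForm hc s x).trans (hybridForm_le_hybridNorm hw hpos _ _ _ x)

/-- The renorming of `ℓ₁` given by `hybridNorm`. -/
noncomputable def hybridRenorming (𝕜 : Type*) [RCLike 𝕜] {w : ℕ → ℝ} (hw : Antitone w) {c : ℝ}
    (hc₀ : 0 < c) (hc : ∀ n, c ≤ w n) : Renorming 𝕜 (lp (fun _ : ℕ => 𝕜) 1) where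
  newNorm := hybridNorm 𝕜 hw fun n => hc₀.le.trans (hc n)
  equivalent := ⟨2 * c, 3 * w 0, by positivity, fun x =>
    ⟨mul_norm_le_hybridNorm hw _ hc₀ hc x, hybridNorm_le hw _ fun D i j =>
      hybridForm_le_of_sum_le hw (fun n => hc₀.le.trans (hc n)) D i j (sum_norm_le_lp_one_norm x)⟩⟩

theorem norm_toSpace_hybridRenorming (hw : Antitone w) {c : ℝ} (hc₀ : 0 < c)
    (hc : ∀ n, c ≤ w n) (x : lp (fun _ : ℕ => 𝕜) 1) :
    ‖(hybridRenorming 𝕜 hw hc₀ hc).toSpace x‖ =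
      hybridNorm 𝕜 hw (fun n => hc₀.le.trans (hc n)) x := rfl

end HybridNorm

/-! ### The unit vector basis of a renorming -/

namespace Renorming

variable {𝕜 : Type*} [RCLike 𝕜] (N : Renorming 𝕜 (lp (fun _ : ℕ => 𝕜) 1))

theorem continuous_toSpace {E : Type*} [NormedAddCommGroup E] [NormedSpace 𝕜 E]
    (N : Renorming 𝕜 E) : Continuous N.toSpace := by
  obtain ⟨c, K, _, h⟩ := N.equivalent
  exact AddMonoidHomClass.continuous_of_bound N.toSpace K fun x => (h x).2

theorem continuous_toSpace_symm {E : Type*} [NormedAddCommGroup E] [NormedSpace 𝕜 E]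
    (N : Renorming 𝕜 E) : Continuous N.toSpace.symm := by
  obtain ⟨c, K, hc, h⟩ := N.equivalent
  refine AddMonoidHomClass.continuous_of_bound N.toSpace.symm c⁻¹ fun x => ?_
  rw [← div_eq_inv_mul, le_div_iff₀' hc]
  exact (h (N.toSpace.symm x)).1

/-- The unit vector system of `ℓ₁` as a Schauder basis of a renorming of `ℓ₁`. -/
noncomputable def unitVectorBasis : SchauderBasis 𝕜 N.Space where
  basis n := N.toSpace (lp.single 1 n (1 : 𝕜))
  coord n := (lp.evalCLM 𝕜 (fun _ : ℕ => 𝕜) 1 n).comp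
    ⟨N.toSpace.symm.toLinearMap, N.continuous_toSpace_symm⟩
  ortho i j := by
    change (lp.single 1 j (1 : 𝕜) : lp (fun _ : ℕ => 𝕜) 1) i = _
    rw [lp.single_apply]
    congr!
  expansion x := by
    have h := (lp.hasSum_single ENNReal.one_ne_top (N.toSpace.symm x)).map N.toSpace
      N.continuous_toSpace
    have hterm : ∀ n, N.toSpace (lp.single 1 n (N.toSpace.symm x n)) =
        N.toSpace.symm x n • N.toSpace (lp.single 1 n (1 : 𝕜)) := fun n => by
      rw [← map_smul, ← lp.single_smul, smul_eq_mul, mul_one]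
    have h' : HasSum (fun n => N.toSpace.symm x n • N.toSpace (lp.single 1 n (1 : 𝕜))) x := by
      simpa only [Function.comp_def, hterm, LinearEquiv.apply_symm_apply] using h
    exact Filter.Tendsto.mono_left h' (SummationFilter.conditional ℕ).le_atTop

@[simp]
theorem unitVectorBasis_apply (n : ℕ) :
    N.unitVectorBasis n = N.toSpace (lp.single 1 n (1 : 𝕜)) := rfl

@[simp]
theorem unitVectorBasis_coord (n : ℕ) (x : lp (fun _ : ℕ => 𝕜) 1) :
    N.unitVectorBasis.coord n (N.toSpace x) = x n := rfl

theorem sum_smul_unitVectorBasis (A : Finset ℕ) (a : ℕ → 𝕜) :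
    ∑ n ∈ A, a n • N.unitVectorBasis n = N.toSpace (∑ n ∈ A, lp.single 1 n (a n)) := by
  rw [map_sum]
  refine Finset.sum_congr rfl fun n _ => ?_
  rw [unitVectorBasis_apply, ← map_smul, ← lp.single_smul, smul_eq_mul, mul_one]

theorem proj_unitVectorBasis (A : Finset ℕ) (x : lp (fun _ : ℕ => 𝕜) 1) :
    GeneralSchauderBasis.proj N.unitVectorBasis A (N.toSpace x) =
      N.toSpace (∑ n ∈ A, lp.single 1 n (x n)) := by
  rw [GeneralSchauderBasis.proj_apply, ← sum_smul_unitVectorBasis]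
  rfl

end Renorming

theorem lp_sum_single_apply {𝕜 : Type*} [RCLike 𝕜] (A : Finset ℕ) (a : ℕ → 𝕜) (k : ℕ) :
    (∑ n ∈ A, lp.single 1 n (a n) : lp (fun _ : ℕ => 𝕜) 1) k = if k ∈ A then a k else 0 := by
  rw [lp.coeFn_sum, Finset.sum_apply]
  simp [Pi.single_apply]

/-! ### Property (A), bidemocracy and bimonotonicity -/

section Properties

variable {𝕜 : Type*} [RCLike 𝕜] {w : ℕ → ℝ} (hw : Antitone w) {c : ℝ} (hc₀ : 0 < c)
  (hc : ∀ n, c ≤ w n)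

theorem SchauderBasis.IsGreedyRearrangement.symm {X : Type*} [NormedAddCommGroup X]
    [NormedSpace 𝕜 X] {b : SchauderBasis 𝕜 X} {x y : X} (h : IsGreedyRearrangement b x y) :
    IsGreedyRearrangement b y x := by
  obtain ⟨π, hπ, hfix⟩ := h
  refine ⟨π.symm, fun n => by rw [← hπ, π.apply_symm_apply], fun k hk ⟨l, hl⟩ => ?_⟩
  obtain ⟨i, rfl⟩ := π.surjective k
  obtain ⟨l, rfl⟩ := π.surjective l
  rw [hπ, hπ] at hl
  rw [← norm_ne_zero_iff, hπ, norm_ne_zero_iff] at hk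
  obtain ⟨h1, h2⟩ := hfix i hk ⟨l, hl⟩
  rw [π.symm_apply_apply, h1]
  exact ⟨rfl, h2.symm⟩

theorem propertyA_hybridRenorming :
    SchauderBasis.PropertyA (hybridRenorming 𝕜 hw hc₀ hc).unitVectorBasis := by
  have key : ∀ x y, SchauderBasis.IsGreedyRearrangement
      (hybridRenorming 𝕜 hw hc₀ hc).unitVectorBasis x y → ‖x‖ ≤ ‖y‖ := by
    intro x y h
    obtain ⟨x, rfl⟩ := (hybridRenorming 𝕜 hw hc₀ hc).toSpace.surjective x
    obtain ⟨y, rfl⟩ := (hybridRenorming 𝕜 hw hc₀ hc).toSpace.surjective y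
    obtain ⟨π, hπ, hfix⟩ := h
    simp only [Renorming.unitVectorBasis_coord] at hπ hfix
    rw [norm_toSpace_hybridRenorming, norm_toSpace_hybridRenorming]
    refine hybridNorm_le _ _ fun D i j => ?_
    obtain ⟨D', hD'⟩ := exists_hybridForm_le_of_greedyRearrangement hw
      (fun n => hc₀.le.trans (hc n)) D i j (tendsto_cofinite_lp_one x) π hπ hfix
    exact hD'.trans (hybridForm_le_hybridNorm _ _ _ _ _ y)
  exact fun x y h => (key x y h).antisymm (key y x h.symm)

theorem fundamentalFunction_unitVectorBasis_le (m : ℕ) :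
    SchauderBasis.fundamentalFunction 𝕜 (hybridRenorming 𝕜 hw hc₀ hc).unitVectorBasis.basis m ≤
      ENNReal.ofReal (doubledPartialSum w m) := by
  have hpos : ∀ n, 0 ≤ w n := fun n => hc₀.le.trans (hc n)
  refine iSup₂_le fun A hA => iSup₂_le fun ε hε => ?_
  rw [Renorming.sum_smul_unitVectorBasis, ← ofReal_norm, norm_toSpace_hybridRenorming]
  refine ENNReal.ofReal_le_ofReal (hybridNorm_le _ _ fun D i j => ?_)
  refine (hybridForm_signs_le hw hpos D A i j (fun n hn => ?_) fun n hn => ?_).trans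
    (doubledPartialSum_mono hpos hA)
  · rw [lp_sum_single_apply, if_pos hn, hε n hn]
  · rw [lp_sum_single_apply, if_neg hn]

theorem fundamentalFunction_coord_le {m : ℕ} (hm : m ≠ 0) :
    SchauderBasis.fundamentalFunction 𝕜 (hybridRenorming 𝕜 hw hc₀ hc).unitVectorBasis.coord m ≤
      ENNReal.ofReal (m / doubledPartialSum w m) := by
  have hpos : ∀ n, 0 ≤ w n := fun n => hc₀.le.trans (hc n)
  have hdiv : ∀ k : ℕ, k ≠ 0 → 0 < doubledPartialSum w k / k := fun k hk =>
    (mul_pos two_pos hc₀).trans_le (le_doubledPartialSum_div hc hk)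
  refine iSup₂_le fun A hA => iSup₂_le fun ε hε => ?_
  rw [← ofReal_norm]
  refine ENNReal.ofReal_le_ofReal ?_
  rw [← inv_div]
  refine ContinuousLinearMap.opNorm_le_bound _ (inv_nonneg.2 (hdiv m hm).le) fun x => ?_
  obtain ⟨x, rfl⟩ := (hybridRenorming 𝕜 hw hc₀ hc).toSpace.surjective x
  rw [← div_eq_inv_mul, le_div_iff₀' (hdiv m hm), norm_toSpace_hybridRenorming]
  -- The empty interval leaves only the weighted ℓ₁ part on A.
  refine le_trans ?_ (hybridForm_le_hybridNorm hw hpos A 0 0 x)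
  refine le_add_of_le_of_nonneg ?_ (norm_nonneg _)
  rcases A.eq_empty_or_nonempty with rfl | hne
  · simp
  refine mul_le_mul (doubledPartialSum_div_anti hw hne.card_ne_zero hA) ?_ (norm_nonneg _)
    (hdiv _ hne.card_ne_zero).le
  rw [sum_apply]
  refine norm_sum_le_of_le _ fun n hn => ?_
  rw [smul_apply, norm_smul, hε n hn, one_mul,
    Renorming.unitVectorBasis_coord]

theorem isIsometricallyBidemocratic_hybridRenorming :
    SchauderBasis.IsIsometricallyBidemocratic
      (hybridRenorming 𝕜 hw hc₀ hc).unitVectorBasis := by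
  intro m
  refine (mul_le_mul_left (fundamentalFunction_unitVectorBasis_le hw hc₀ hc m) _).trans ?_
  rcases eq_or_ne m 0 with rfl | hm
  · simp [doubledPartialSum_zero]
  have hpos : 0 < doubledPartialSum w m := by
    have := (mul_pos two_pos hc₀).trans_le (le_doubledPartialSum_div hc hm)
    exact (div_pos_iff_of_pos_right (by positivity)).1 this
  refine (mul_le_mul_right (fundamentalFunction_coord_le hw hc₀ hc hm) _).trans ?_
  rw [← ENNReal.ofReal_mul hpos.le, mul_div_cancel₀ _ hpos.ne', ENNReal.ofReal_natCast]

theorem isBimonotone_hybridRenorming :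
    SchauderBasis.IsBimonotone (hybridRenorming 𝕜 hw hc₀ hc).unitVectorBasis := by
  have hpos : ∀ n, 0 ≤ w n := fun n => hc₀.le.trans (hc n)
  refine ⟨fun i j x => ?_, fun i x => ?_⟩ <;>
    obtain ⟨x, rfl⟩ := (hybridRenorming 𝕜 hw hc₀ hc).toSpace.surjective x <;>
    rw [Renorming.proj_unitVectorBasis]
  · rw [norm_toSpace_hybridRenorming, norm_toSpace_hybridRenorming]
    refine hybridNorm_le _ _ fun D i' j' => le_trans ?_ (hybridForm_le_hybridNorm hw hpos
      D (max i' i) (min j' j) x)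
    refine hybridForm_interval_le hpos _ _ _ _ _ (fun n h1 h2 => ?_) (fun n _ _ h => ?_)
      fun n => ?_ <;> rw [lp_sum_single_apply]
    · rw [if_pos (Finset.mem_Ico.2 ⟨h1, h2⟩)]
    · rw [if_neg (mt Finset.mem_Ico.1 h)]
    · split_ifs <;> simp
  · rw [← map_sub, norm_toSpace_hybridRenorming, norm_toSpace_hybridRenorming]
    -- The form sees only indices below `j'`, so the half-line from `i` acts as [i, j').
    refine hybridNorm_le _ _ fun D i' j' => le_trans ?_ (hybridForm_le_hybridNorm hw hpos
      D (max i' i) (min j' j') x)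
    refine hybridForm_interval_le hpos _ _ _ _ _ (fun n h1 h2 => ?_) (fun n _ h2 h => ?_)
      fun n => ?_ <;> rw [lp.coeFn_sub, Pi.sub_apply, lp_sum_single_apply]
    · rw [if_neg (by simpa using h1), sub_zero]
    · rw [if_pos (by simp; omega), sub_self]
    · split_ifs <;> simp

end Properties

/-! ### Inverse square roots and alternating sums -/

section InverseSqrt

theorem sum_le_sum_range_card {f : ℕ → ℝ} (hf : Antitone f) (D : Finset ℕ) :
    ∑ n ∈ D, f n ≤ ∑ n ∈ Finset.range D.card, f n := by
  induction D using Finset.induction_on_max with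
  | empty => simp
  | insert a D ha ih =>
    have haD : a ∉ D := fun h => (ha a h).false
    have hcard : D.card ≤ a := by
      simpa using Finset.card_le_card (t := Finset.range a) fun n hn => Finset.mem_range.2 (ha n hn)
    rw [Finset.sum_insert haD, Finset.card_insert_of_notMem haD, Finset.sum_range_succ, add_comm]
    exact add_le_add ih (hf hcard)

/-- The sequence `1 / √(n + 1)`. -/
noncomputable def invSqrtSucc (n : ℕ) : ℝ := (√(n + 1 : ℝ))⁻¹

theorem invSqrtSucc_pos (n : ℕ) : 0 < invSqrtSucc n := by
  unfold invSqrtSucc; positivity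

theorem invSqrtSucc_antitone : Antitone invSqrtSucc := fun m n h => by
  unfold invSqrtSucc
  have : (m : ℝ) ≤ n := mod_cast h
  gcongr

theorem invSqrtSucc_mul_self (n : ℕ) : invSqrtSucc n * invSqrtSucc n = ((n : ℝ) + 1)⁻¹ := by
  rw [invSqrtSucc, ← mul_inv, Real.mul_self_sqrt (by positivity)]

theorem sum_range_invSqrtSucc_le (m : ℕ) :
    ∑ n ∈ Finset.range m, invSqrtSucc n ≤ 2 * √(m : ℝ) := by
  induction m with
  | zero => simp
  | succ m ih =>
    rw [Finset.sum_range_succ]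
    have h1 : √(m + 1 : ℝ) ^ 2 = m + 1 := Real.sq_sqrt (by positivity)
    have h2 : √(m : ℝ) ^ 2 = m := Real.sq_sqrt (by positivity)
    have h3 : invSqrtSucc m ≤ 2 * (√(m + 1 : ℝ) - √(m : ℝ)) := by
      rw [invSqrtSucc, inv_le_iff_one_le_mul₀ (by positivity)]
      nlinarith [sq_nonneg (√(m + 1 : ℝ) - √(m : ℝ))]
    push_cast
    linarith

theorem alternating_sum_mem_Icc {v : ℕ → ℝ} (hv : Antitone v) (hpos : ∀ n, 0 ≤ v n) (a k : ℕ) :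
    ∑ t ∈ Finset.range k, (-1) ^ t * v (a + t) ∈ Set.Icc 0 (v a) := by
  induction k generalizing a with
  | zero => simpa using hpos a
  | succ k ih =>
    have h : ∑ t ∈ Finset.range (k + 1), (-1) ^ t * v (a + t) =
        v a - ∑ t ∈ Finset.range k, (-1) ^ t * v (a + 1 + t) := by
      rw [Finset.sum_range_succ', sub_eq_neg_add, ← Finset.sum_neg_distrib]
      congr 1
      · refine Finset.sum_congr rfl fun t _ => ?_
        rw [pow_succ, add_right_comm, add_assoc a t 1]; ring
      · simp
    have h1 := ih (a + 1)
    have h2 := hv (Nat.le_succ a)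
    rw [h]
    constructor <;> [linarith [h1.2]; linarith [h1.1]]

theorem abs_alternating_sum_Ico_le {v : ℕ → ℝ} (hv : Antitone v) (hpos : ∀ n, 0 ≤ v n)
    (a b : ℕ) : |∑ n ∈ Finset.Ico a b, (-1) ^ n * v n| ≤ v a := by
  have h := alternating_sum_mem_Icc hv hpos a (b - a)
  rw [Finset.sum_Ico_eq_sum_range]
  simp only [pow_add, mul_assoc, ← Finset.mul_sum]
  rw [abs_mul, abs_pow, abs_neg, abs_one, one_pow, one_mul, abs_of_nonneg h.1]
  exact h.2

end InverseSqrt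

/-! ### Failure of suppression unconditionality -/

section AlternatingVector

variable (𝕜 : Type*) [RCLike 𝕜]

/-- The sequence `1 / √(n + 1)`, constant from its `M`-th term on. -/
noncomputable def truncatedWeight (M n : ℕ) : ℝ := invSqrtSucc (min n M)

theorem truncatedWeight_antitone (M : ℕ) : Antitone (truncatedWeight M) := fun _ _ h =>
  invSqrtSucc_antitone (min_le_min_right M h)

theorem invSqrtSucc_le_truncatedWeight (M n : ℕ) : invSqrtSucc M ≤ truncatedWeight M n :=
  invSqrtSucc_antitone (min_le_right n M)

theorem truncatedWeight_pos (M n : ℕ) : 0 < truncatedWeight M n := invSqrtSucc_pos _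

theorem truncatedWeight_of_le {M n : ℕ} (h : n ≤ M) : truncatedWeight M n = invSqrtSucc n := by
  rw [truncatedWeight, min_eq_left h]

/-- The coefficients `(-1) ^ n / √(n + 1)` for `n < M`. -/
noncomputable def alternatingVector (M n : ℕ) : 𝕜 :=
  if n < M then (((-1) ^ n * invSqrtSucc n : ℝ) : 𝕜) else 0

variable {𝕜}

theorem norm_alternatingVector (M n : ℕ) :
    ‖alternatingVector 𝕜 M n‖ = if n < M then invSqrtSucc n else 0 := by
  rw [alternatingVector]
  split_ifs
  · rw [RCLike.norm_ofReal, abs_mul, abs_pow, abs_neg, abs_one, one_pow, one_mul,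
      abs_of_pos (invSqrtSucc_pos n)]
  · exact norm_zero

theorem truncatedWeight_mul_alternatingVector (M n : ℕ) :
    (truncatedWeight M n : 𝕜) * alternatingVector 𝕜 M n =
      ((if n < M then (-1) ^ n * ((n : ℝ) + 1)⁻¹ else 0 : ℝ) : 𝕜) := by
  rw [alternatingVector]
  split_ifs with h
  · rw [truncatedWeight_of_le h.le, ← RCLike.ofReal_mul, mul_left_comm, invSqrtSucc_mul_self]
  · simp

/-- Only the r indices of D below M contribute, and shrinking D to them raises the average. There
φ(r)/r ≤ 4/√r and the sum is at most 2√r. -/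
theorem doubledPartialSum_div_mul_sum_alternatingVector_le (M : ℕ) (D : Finset ℕ) :
    doubledPartialSum (truncatedWeight M) D.card / D.card *
      ∑ n ∈ D, ‖alternatingVector 𝕜 M n‖ ≤ 8 := by
  simp only [norm_alternatingVector, ← Finset.sum_filter]
  set D' := D.filter (· < M)
  rcases D'.eq_empty_or_nonempty with h | h
  · rw [h]; simp
  have hr : (0 : ℝ) < D'.card := by exact_mod_cast h.card_pos
  have hle : D'.card ≤ M := by
    simpa using Finset.card_le_card (t := Finset.range M) fun n hn =>
      Finset.mem_range.2 (Finset.mem_filter.1 hn).2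
  have hsum : ∑ n ∈ D', invSqrtSucc n ≤ 2 * √(D'.card : ℝ) :=
    (sum_le_sum_range_card invSqrtSucc_antitone D').trans (sum_range_invSqrtSucc_le _)
  have hφ : doubledPartialSum (truncatedWeight M) D'.card ≤ 2 * (2 * √(D'.card : ℝ)) := by
    refine mul_le_mul_of_nonneg_left (le_trans (Finset.sum_le_sum fun n hn => ?_)
      (sum_range_invSqrtSucc_le _)) zero_le_two
    exact (truncatedWeight_of_le ((Finset.mem_range.1 hn).le.trans hle)).le
  calc _ ≤ 2 * (2 * √(D'.card : ℝ)) / D'.card * (2 * √(D'.card : ℝ)) := by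
        refine mul_le_mul ((doubledPartialSum_div_anti (truncatedWeight_antitone M)
          h.card_ne_zero (Finset.card_le_card (Finset.filter_subset _ _))).trans ?_) hsum
          (Finset.sum_nonneg fun n _ => (invSqrtSucc_pos n).le) (by positivity)
        gcongr
    _ = 8 * (√(D'.card : ℝ) * √(D'.card : ℝ)) / D'.card := by ring
    _ = 8 := by rw [Real.mul_self_sqrt hr.le, mul_div_cancel_right₀ _ hr.ne']

/-- The products w_n x_n are alternating reciprocals. With d = #D, a full alternating sum starting
at or beyond d is at most 1/(d+1), and removing D deletes at most d terms, each at most 1/(d+1). -/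
theorem norm_sum_tailIndices_alternatingVector_le (M : ℕ) (D : Finset ℕ) (i j : ℕ) :
    ‖∑ n ∈ tailIndices D i j, (truncatedWeight M n : 𝕜) * alternatingVector 𝕜 M n‖ ≤ 1 := by
  simp only [truncatedWeight_mul_alternatingVector]
  rw [← RCLike.ofReal_sum, RCLike.norm_ofReal, ← Finset.sum_filter]
  set v : ℕ → ℝ := fun n => ((n : ℝ) + 1)⁻¹
  have hv : Antitone v := fun m n h => by
    have : (m : ℝ) ≤ n := mod_cast h
    simp only [v]
    gcongr
  have hpos : ∀ n, 0 ≤ v n := fun n => by simp only [v]; positivity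
  set J := Finset.Ico (max i D.card) (min j M)
  have hset : (tailIndices D i j).filter (· < M) = J \ D := by
    ext n
    simp only [tailIndices, J, Finset.mem_filter, Finset.mem_sdiff, Finset.mem_Ico]
    grind
  rw [hset, ← Finset.sdiff_inter_self_left J D,
    Finset.sum_sdiff_eq_sub Finset.inter_subset_left]
  have h1 : |∑ n ∈ J, (-1) ^ n * v n| ≤ v D.card :=
    (abs_alternating_sum_Ico_le hv hpos _ _).trans (hv (le_max_right _ _))
  have h2 : |∑ n ∈ J ∩ D, (-1) ^ n * v n| ≤ D.card * v D.card := by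
    refine (Finset.abs_sum_le_sum_abs _ _).trans ((Finset.sum_le_card_nsmul _ _ (v D.card)
      fun n hn => ?_).trans ?_)
    · rw [abs_mul, abs_pow, abs_neg, abs_one, one_pow, one_mul, abs_of_nonneg (hpos n)]
      have := Finset.mem_Ico.1 (Finset.mem_inter.1 hn).1
      exact hv ((le_max_right _ _).trans this.1)
    · rw [nsmul_eq_mul]
      exact mul_le_mul_of_nonneg_right
        (mod_cast Finset.card_le_card Finset.inter_subset_right) (hpos _)
  have h3 : v D.card + D.card * v D.card = 1 := by
    simp only [v]; field_simp; ring
  exact (abs_sub _ _).trans (by linarith)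

theorem hybridForm_alternatingVector_le (M : ℕ) (D : Finset ℕ) (i j : ℕ) :
    hybridForm (truncatedWeight M) D i j (alternatingVector 𝕜 M) ≤ 9 := by
  have h1 := doubledPartialSum_div_mul_sum_alternatingVector_le (𝕜 := 𝕜) M D
  have h2 := norm_sum_tailIndices_alternatingVector_le (𝕜 := 𝕜) M D i j
  rw [hybridForm]; linarith

theorem hybridForm_even_alternatingVector (K : ℕ) :
    ∑ k ∈ Finset.range K, ((2 * k : ℕ) + 1 : ℝ)⁻¹ ≤
      hybridForm (truncatedWeight (2 * K)) ∅ 0 (2 * K) (fun n =>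
        if n ∈ (Finset.range K).image (2 * ·) then alternatingVector 𝕜 (2 * K) n else 0) := by
  have htail : tailIndices ∅ 0 (2 * K) = Finset.range (2 * K) := by
    ext; simp [tailIndices]
  have hsub : (Finset.range K).image (2 * ·) ⊆ Finset.range (2 * K) := by
    intro n hn
    obtain ⟨k, hk, rfl⟩ := Finset.mem_image.1 hn
    have := Finset.mem_range.1 hk
    exact Finset.mem_range.2 (by omega)
  simp only [hybridForm, htail, Finset.sum_empty, mul_zero, zero_add, mul_ite]
  rw [Finset.sum_ite_mem, Finset.inter_eq_right.2 hsub,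
    Finset.sum_image fun a _ b _ h => by simpa using h]
  simp only [truncatedWeight_mul_alternatingVector]
  rw [← RCLike.ofReal_sum, RCLike.norm_ofReal]
  refine le_trans (Finset.sum_le_sum fun k hk => ?_) (le_abs_self _)
  have := Finset.mem_range.1 hk
  rw [if_pos (by omega), pow_mul]
  simp

theorem not_isSuppressionUnconditional_hybridRenorming (C : ℝ) : ∃ M : ℕ,
    ¬ SchauderBasis.IsSuppressionUnconditional (hybridRenorming 𝕜 (truncatedWeight_antitone M)
      (invSqrtSucc_pos M) (invSqrtSucc_le_truncatedWeight M)).unitVectorBasis C := by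
  -- The 9 bounds the norm of the vector; the 2 is lost in comparing 1/(2k+1) with half of 1/(k+1).
  obtain ⟨K, hK⟩ := (Real.tendsto_sum_range_one_div_nat_succ_atTop.eventually_gt_atTop
    (2 * (9 * |C|))).exists
  refine ⟨2 * K, fun h => ?_⟩
  let x : lp (fun _ : ℕ => 𝕜) 1 :=
    ∑ n ∈ Finset.range (2 * K), lp.single 1 n (alternatingVector 𝕜 (2 * K) n)
  have hx : (x : ℕ → 𝕜) = alternatingVector 𝕜 (2 * K) := by
    ext n
    rw [lp_sum_single_apply]
    by_cases hn : n < 2 * K <;> simp [alternatingVector, hn]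
  have hpos : ∀ n, 0 ≤ truncatedWeight (2 * K) n := fun n => (truncatedWeight_pos _ n).le
  have h1 := h ((Finset.range K).image (2 * ·)) (Renorming.toSpace _ x)
  rw [Renorming.proj_unitVectorBasis, norm_toSpace_hybridRenorming,
    norm_toSpace_hybridRenorming] at h1
  have h2 : hybridNorm 𝕜 (truncatedWeight_antitone (2 * K)) hpos x ≤ 9 :=
    hybridNorm_le _ _ fun D i j => by
      rw [hx]; exact hybridForm_alternatingVector_le _ D i j
  have h3 := (hybridForm_even_alternatingVector (𝕜 := 𝕜) K).trans_eq (congrArg _ (funext fun n =>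
    (lp_sum_single_apply ((Finset.range K).image (2 * ·)) (alternatingVector 𝕜 (2 * K)) n).symm))
  rw [← hx] at h3
  have h4 := hybridForm_le_hybridNorm (truncatedWeight_antitone (2 * K)) hpos ∅ 0 (2 * K)
    (∑ n ∈ (Finset.range K).image (2 * ·), lp.single 1 n (x n))
  have h5 : (∑ k ∈ Finset.range K, 1 / ((k : ℝ) + 1)) / 2 ≤
      ∑ k ∈ Finset.range K, ((2 * k : ℕ) + 1 : ℝ)⁻¹ := by
    rw [Finset.sum_div]
    refine Finset.sum_le_sum fun k _ => ?_
    rw [div_div, one_div]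
    push_cast
    gcongr
    linarith
  have h6 : C * hybridNorm 𝕜 (truncatedWeight_antitone (2 * K)) hpos x ≤ |C| * 9 :=
    mul_le_mul (le_abs_self C) h2 (apply_nonneg _ _) (abs_nonneg C)
  linarith

end AlternatingVector

theorem mainTheorem4 {𝕜 : Type*} [RCLike 𝕜] (C : ℝ) (hC : 1 ≤ C) :
    ∃ (N : Renorming 𝕜 (lp (fun _ : ℕ => 𝕜) 1)) (b : SchauderBasis 𝕜 N.Space),
      (∀ n : ℕ, b n = N.toSpace (lp.single 1 n (1 : 𝕜))) ∧
      SchauderBasis.PropertyA b ∧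
      ¬ SchauderBasis.IsSuppressionUnconditional b C ∧
      SchauderBasis.IsIsometricallyBidemocratic b ∧
      SchauderBasis.IsBimonotone b := by
  obtain ⟨M, hM⟩ := not_isSuppressionUnconditional_hybridRenorming (𝕜 := 𝕜) C
  exact ⟨_, _, fun n => rfl, propertyA_hybridRenorming _ _ _, hM,
    isIsometricallyBidemocratic_hybridRenorming _ _ _, isBimonotone_hybridRenorming _ _ _⟩
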